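/- All graphs are finite and simple. For a graph $G$, a weight assignment is a function $w:V(G)\to[0,\infty)$ that is not identically $0$; let $\alpha_w(G)=\max\{\sum_{y\in Y}w(y) : Y\subseteq V(G)\text{ independent in }G\}$. The fractional chromatic number $\chi_f(G)$ is the supremum of $\frac{\sum_{v\in V(G)}w(v)}{\alpha_w(G)}$ over all weight assignments $w$ for $G$. A shallow minor of $G$ at depth $r$ is any graph that can be obtained from $G$ by deleting vertices and edges and contracting pairwise vertex-disjoint subgraphs, each of radius at most $r$. (For the graph with no vertices, the average degree and $\chi_f$ are $0$.) A class $\mathcal C$ of graphs has bounded expansion if there exists a function $f_1:\mathbb N\to\mathbb R$ such that for every $r\in\mathbb N$, every shallow minor at depth $r$ of a graph in $\mathcal C$ has average degree at most $f_1(r)$. Corollary. A class $\mathcal C$ of graphs has bounded expansion if and only if there exists a function $f_5:\mathbb N\to\mathbb N$ such that for every $r\in\mathbb N$ and every shallow minor $G$ at depth $r$ of a graph in $\mathcal C$ we have $\chi_f(G)\le f_5(r)$. -/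

import Mathlib

universe u

namespace ShallowMinors

/-- The average degree of a finite graph (equal to `0` for the graph with no vertices). -/
noncomputable def averageDegree {V : Type u} [Fintype V] (G : SimpleGraph V) : ℝ :=
  open Classical in (∑ v, (G.degree v : ℝ)) / (Fintype.card V : ℝ)

/-- A weight assignment: a nonnegative real function on the vertices, not identically `0`. -/
def IsWeightAssignment {V : Type u} (w : V → ℝ) : Prop :=
  (∀ v, 0 ≤ w v) ∧ ∃ v, w v ≠ 0

/-- The finite set of all independent sets of a finite graph. -/
noncomputable def indepSets {V : Type u} [Fintype V] (G : SimpleGraph V) : Finset (Finset V) :=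
  open Classical in Finset.univ.filter fun Y => G.IsIndepSet (Y : Set V)

theorem mem_indepSets {V : Type u} [Fintype V] {G : SimpleGraph V} {Y : Finset V} :
    Y ∈ indepSets G ↔ G.IsIndepSet (Y : Set V) := by
  simp [indepSets]

theorem indepSets_nonempty {V : Type u} [Fintype V] (G : SimpleGraph V) :
    (indepSets G).Nonempty :=
  ⟨∅, by simp [mem_indepSets]⟩

/-- The maximum weight of an independent set of `G`. -/
noncomputable def maxIndepWeight {V : Type u} [Fintype V] (G : SimpleGraph V) (w : V → ℝ) : ℝ :=
  (indepSets G).sup' (indepSets_nonempty G) fun Y => ∑ y ∈ Y, w y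

/-- The set of all ratios of the total weight to the maximum weight of an independent set. -/
def weightRatios {V : Type u} [Fintype V] (G : SimpleGraph V) : Set ℝ :=
  {x | ∃ w : V → ℝ, IsWeightAssignment w ∧ x = (∑ v, w v) / maxIndepWeight G w}

/-- The fractional chromatic number: the supremum of `w(V(G)) / α_w(G)` over all weight
assignments `w` (equal to `0` for the graph with no vertices). The supremum is over a bounded
set, see `bddAbove_weightRatios`. -/
noncomputable def fractionalChromaticNumber {V : Type u} [Fintype V] (G : SimpleGraph V) : ℝ :=
  sSup (weightRatios G)

theorem le_maxIndepWeight {V : Type u} [Fintype V] (G : SimpleGraph V) (w : V → ℝ) (v : V) :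
    w v ≤ maxIndepWeight G w := by
  have h : ({v} : Finset V) ∈ indepSets G := by simp [mem_indepSets]
  have h' : ∑ y ∈ ({v} : Finset V), w y ≤ maxIndepWeight G w :=
    Finset.le_sup' (fun Y : Finset V => ∑ y ∈ Y, w y) h
  rwa [Finset.sum_singleton] at h'

theorem bddAbove_weightRatios {V : Type u} [Fintype V] (G : SimpleGraph V) :
    BddAbove (weightRatios G) := by
  refine ⟨Fintype.card V, ?_⟩
  rintro x ⟨w, ⟨hw, v, hv⟩, rfl⟩
  have hpos : 0 < maxIndepWeight G w :=
    lt_of_lt_of_le (lt_of_le_of_ne (hw v) hv.symm) (le_maxIndepWeight G w v)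
  rw [div_le_iff₀ hpos]
  calc ∑ v, w v ≤ ∑ _v : V, maxIndepWeight G w :=
        Finset.sum_le_sum fun v _ => le_maxIndepWeight G w v
    _ = Fintype.card V * maxIndepWeight G w := by simp

/-- `H` is a shallow minor of `G` at depth `r`: the vertices of `H` are obtained by contracting
pairwise vertex-disjoint subgraphs of `G` of radius at most `r`, the vertices of `G` outside these
subgraphs being deleted, and every edge of `H` comes from an edge of `G` between the two
corresponding subgraphs (the other edges being deleted). The radius of a graph is the `ℕ∞`-valued
one, infinite for empty and for disconnected graphs, and is measured inside the subgraph. -/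
def IsShallowMinor {V W : Type u} (r : ℕ) (H : SimpleGraph W) (G : SimpleGraph V) : Prop :=
  ∃ B : W → G.Subgraph,
    (∀ x, (B x).coe.radius ≤ (r : ℕ∞)) ∧
    (∀ x y, x ≠ y → Disjoint (B x).verts (B y).verts) ∧
    (∀ x y, H.Adj x y → ∃ a ∈ (B x).verts, ∃ b ∈ (B y).verts, G.Adj a b)

/-- A finite simple graph. -/
structure FiniteGraph where
  /-- The vertex set. -/
  V : Type u
  [fintypeV : Fintype V]
  /-- The graph on this vertex set. -/
  graph : SimpleGraph V

attribute [instance] FiniteGraph.fintypeV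

/-- The class of all shallow minors at depth `r` of graphs of the class `C`. -/
def shallowMinors (C : Set FiniteGraph.{u}) (r : ℕ) : Set FiniteGraph.{u} :=
  {H | ∃ G ∈ C, IsShallowMinor r H.graph G.graph}

/-- The class `C` has bounded expansion. -/
def HasBoundedExpansion (C : Set FiniteGraph.{u}) : Prop :=
  ∃ f : ℕ → ℝ, ∀ r : ℕ, ∀ H ∈ shallowMinors C r, averageDegree H.graph ≤ f r

end ShallowMinors

namespace ShallowMinors

/-! Bounded average degree of all induced subgraphs gives degeneracy, hence a proper colouring,
which bounds `fractionalChromaticNumber`. Conversely, if a depth-`r` minor is not degenerate, some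
induced subgraph has large minimum degree. `exists_shallowMinor_lt_fractionalChromaticNumber` finds
in it a depth-1 minor of large fractional chromatic number, and by `IsShallowMinor.trans` this is a
depth-`3r + 1` minor of the original graph. That lemma is probabilistic. A random colour class `T`
leaves many outside vertices `a`, far more than `#T`, with many neighbours in `T`
(`exists_small_set_hit_often`). Each `a` picks a random pair of its neighbours in `T` and is
contracted into the first, creating an edge to the second. Let each `a` spread unit weight evenly
over its neighbours in `T`. A set `Y` carrying a `1 / c` share of the weight is independent with
probability at most `exp (-#T)`, so a union bound over the `2 ^ #T` sets `Y` leaves a choice with no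
heavy independent set (`exists_pairs_forall_sum_lt`). -/

/-! ### Radius via walks, and composition of shallow minors. -/

/-- Some vertex of `s` reaches every vertex of `s` by a walk of length at most `r` inside `s`. -/
def HasRadiusLE {V : Type u} (G : SimpleGraph V) (r : ℕ) (s : Set V) : Prop :=
  ∃ c ∈ s, ∀ v ∈ s, ∃ p : G.Walk c v, p.length ≤ r ∧ ∀ u ∈ p.support, u ∈ s

theorem exists_coe_walk {V : Type u} {G : SimpleGraph V} {s : Set V} {c v : V} (p : G.Walk c v)
    (hp : ∀ u ∈ p.support, u ∈ s) (hc : c ∈ s) (hv : v ∈ s) :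
    ∃ q : ((⊤ : G.Subgraph).induce s).coe.Walk ⟨c, hc⟩ ⟨v, hv⟩, q.length = p.length := by
  induction p with
  | nil => exact ⟨.nil, rfl⟩
  | @cons a b d hab p ih =>
    have hb : b ∈ s := hp b (by simp)
    obtain ⟨q, hq⟩ := ih (fun u hu => hp u (by simp [hu])) hb hv
    have hadj : ((⊤ : G.Subgraph).induce s).coe.Adj ⟨a, hc⟩ ⟨b, hb⟩ := by simp [hc, hb, hab]
    exact ⟨.cons hadj q, by rw [SimpleGraph.Walk.length_cons, SimpleGraph.Walk.length_cons, hq]⟩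

theorem HasRadiusLE.radius_coe_le {V : Type u} {G : SimpleGraph V} {r : ℕ} {s : Set V}
    (h : HasRadiusLE G r s) : ((⊤ : G.Subgraph).induce s).coe.radius ≤ (r : ℕ∞) := by
  obtain ⟨c, hc, h⟩ := h
  refine (iInf_le _ (⟨c, hc⟩ : ((⊤ : G.Subgraph).induce s).verts)).trans ?_
  rw [SimpleGraph.eccent_le_iff]
  rintro ⟨v, hv⟩
  obtain ⟨p, hpr, hp⟩ := h v hv
  obtain ⟨q, hq⟩ := exists_coe_walk p hp hc hv
  refine (SimpleGraph.edist_le q).trans ?_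
  rw [hq]
  exact_mod_cast hpr

theorem hasRadiusLE_verts {V : Type u} {G : SimpleGraph V} {r : ℕ} {B : G.Subgraph}
    (h : B.coe.radius ≤ (r : ℕ∞)) : HasRadiusLE G r B.verts := by
  -- An empty subgraph has infinite radius, so branch sets are nonempty.
  rcases isEmpty_or_nonempty B.verts with hB | hB
  · rw [SimpleGraph.radius, iInf_of_empty, top_le_iff] at h
    exact absurd h (ENat.natCast_ne_top r)
  obtain ⟨c, hc⟩ := B.coe.exists_eccent_eq_radius
  rw [← hc, SimpleGraph.eccent_le_iff] at h
  refine ⟨c, c.2, fun v hv => ?_⟩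
  have hle := h ⟨v, hv⟩
  obtain ⟨p, hp⟩ := SimpleGraph.exists_walk_of_edist_ne_top
    (ne_top_of_le_ne_top (ENat.natCast_ne_top r) hle)
  refine ⟨p.map B.hom, ?_, ?_⟩
  · rw [← hp] at hle
    exact (SimpleGraph.Walk.length_map B.hom p).le.trans (by exact_mod_cast hle)
  · intro u hu
    obtain ⟨x, -, rfl⟩ := List.mem_map.1 (SimpleGraph.Walk.support_map B.hom p ▸ hu)
    exact x.2

theorem isShallowMinor_iff {V W : Type u} {r : ℕ} {H : SimpleGraph W} {G : SimpleGraph V} :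
    IsShallowMinor r H G ↔ ∃ B : W → Set V, (∀ x, HasRadiusLE G r (B x)) ∧
      (∀ x y, x ≠ y → Disjoint (B x) (B y)) ∧
      (∀ x y, H.Adj x y → ∃ a ∈ B x, ∃ b ∈ B y, G.Adj a b) := by
  constructor
  · rintro ⟨B, hr, hd, he⟩
    exact ⟨fun x => (B x).verts, fun x => hasRadiusLE_verts (hr x), hd, he⟩
  · rintro ⟨B, hr, hd, he⟩
    exact ⟨fun x => (⊤ : G.Subgraph).induce (B x), fun x => (hr x).radius_coe_le, hd, he⟩

/-- Replace each vertex of a branch set by its own branch set. A walk between centres costs at most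
`r + 1 + r` per edge, and a last stretch of length `r` leads from a centre to an arbitrary vertex.
-/
theorem IsShallowMinor.trans {U V W : Type u} {r s : ℕ} {F : SimpleGraph U} {G : SimpleGraph V}
    {H : SimpleGraph W} (hHG : IsShallowMinor s H G) (hGF : IsShallowMinor r G F) :
    IsShallowMinor (s * (2 * r + 1) + r) H F := by
  rw [isShallowMinor_iff] at *
  obtain ⟨B, hB, hBd, hBe⟩ := hHG
  obtain ⟨D, hD, hDd, hDe⟩ := hGF
  choose d hd hdw using hD
  have lift : ∀ (S : Set V) (x y : V) (p : G.Walk x y), (∀ u ∈ p.support, u ∈ S) →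
      ∃ q : F.Walk (d x) (d y), q.length ≤ p.length * (2 * r + 1) ∧
        ∀ u ∈ q.support, u ∈ ⋃ z ∈ S, D z := by
    intro S x y p hp
    induction p with
    | @nil x =>
      refine ⟨.nil, by simp, fun u hu => ?_⟩
      simp only [SimpleGraph.Walk.support_nil, List.mem_singleton] at hu
      subst hu
      exact Set.mem_biUnion (hp x (by simp)) (hd x)
    | @cons x z y hxz p ih =>
      obtain ⟨q, hq, hqS⟩ := ih fun u hu => hp u (by simp [hu])
      obtain ⟨a, ha, b, hb, hab⟩ := hDe x z hxz
      obtain ⟨p₁, hp₁, hs₁⟩ := hdw x a ha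
      obtain ⟨p₂, hp₂, hs₂⟩ := hdw z b hb
      refine ⟨p₁.append (.cons hab (p₂.reverse.append q)), ?_, ?_⟩
      · simp only [SimpleGraph.Walk.length_append, SimpleGraph.Walk.length_cons,
          SimpleGraph.Walk.length_reverse]
        nlinarith
      · intro u hu
        have hxS : x ∈ S := hp x (by simp)
        have hzS : z ∈ S := hp z (by simp)
        simp only [SimpleGraph.Walk.mem_support_append_iff, SimpleGraph.Walk.support_cons,
          List.mem_cons, SimpleGraph.Walk.support_reverse, List.mem_reverse] at hu
        rcases hu with hu | rfl | hu | hu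
        · exact Set.mem_biUnion hxS (hs₁ u hu)
        · exact Set.mem_biUnion hxS ha
        · exact Set.mem_biUnion hzS (hs₂ u hu)
        · exact hqS u hu
  refine ⟨fun x => ⋃ z ∈ B x, D z, fun x => ?_, fun x y hxy => ?_, fun x y hxy => ?_⟩
  · obtain ⟨c, hc, hcw⟩ := hB x
    refine ⟨d c, Set.mem_biUnion hc (hd c), fun v hv => ?_⟩
    obtain ⟨z, hz, hvz⟩ := Set.mem_iUnion₂.1 hv
    obtain ⟨p, hpl, hps⟩ := hcw z hz
    obtain ⟨q, hql, hqs⟩ := lift (B x) c z p hps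
    obtain ⟨t, htl, hts⟩ := hdw z v hvz
    refine ⟨q.append t, ?_, fun u hu => ?_⟩
    · rw [SimpleGraph.Walk.length_append]
      have := Nat.mul_le_mul_right (2 * r + 1) hpl
      omega
    · rw [SimpleGraph.Walk.mem_support_append_iff] at hu
      exact hu.elim (hqs u) fun hu => Set.mem_biUnion hz (hts u hu)
  · simp only [Set.disjoint_iUnion_left, Set.disjoint_iUnion_right]
    intro z hz z' hz'
    refine hDd _ _ fun h => ?_
    subst h
    exact (Set.disjoint_left.1 (hBd x y hxy)) (by assumption) (by assumption)
  · obtain ⟨z, hz, z', hz', h⟩ := hBe x y hxy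
    obtain ⟨a, ha, b, hb, hab⟩ := hDe z z' h
    exact ⟨a, Set.mem_biUnion hz ha, b, Set.mem_biUnion hz' hb, hab⟩

theorem IsShallowMinor.induce {V W : Type u} {r : ℕ} {H : SimpleGraph W} {G : SimpleGraph V}
    (h : IsShallowMinor r H G) (S : Set W) : IsShallowMinor r (H.induce S) G := by
  obtain ⟨B, hr, hd, he⟩ := h
  exact ⟨fun x => B x, fun x => hr x, fun x y hxy => hd x y fun h => hxy (Subtype.ext h),
    fun x y hxy => he x y hxy⟩

open Finset

/-! ### Colourings, degeneracy and average degree. -/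

theorem fractionalChromaticNumber_le_of_coloring {V : Type u} [Fintype V] {G : SimpleGraph V}
    {k : ℕ} (c : G.Coloring (Fin k)) : fractionalChromaticNumber G ≤ k := by
  classical
  refine Real.sSup_le ?_ (Nat.cast_nonneg k)
  rintro x ⟨w, ⟨hw, v, hv⟩, rfl⟩
  have hpos : 0 < maxIndepWeight G w :=
    lt_of_lt_of_le (lt_of_le_of_ne (hw v) hv.symm) (le_maxIndepWeight G w v)
  rw [div_le_iff₀ hpos]
  calc ∑ v, w v = ∑ i : Fin k, ∑ v with c v = i, w v := (sum_fiberwise _ _ _).symm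
    _ ≤ ∑ _i : Fin k, maxIndepWeight G w := by
      refine sum_le_sum fun i _ => ?_
      refine Finset.le_sup' (fun Y : Finset V => ∑ y ∈ Y, w y) (mem_indepSets.2 ?_)
      intro x hx y hy _ hxy
      simp only [coe_filter, mem_univ, true_and, Set.mem_ofPred_eq] at hx hy
      exact c.valid hxy (hx.trans hy.symm)
    _ = k * maxIndepWeight G w := by simp

open Classical in
/-- Every nonempty set of vertices has a vertex with at most `k` neighbours inside the set. -/
def IsDegenerate {V : Type u} [Fintype V] (G : SimpleGraph V) (k : ℕ) : Prop :=
  ∀ S : Finset V, S.Nonempty → ∃ v ∈ S, #{u ∈ S | G.Adj v u} ≤ k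

theorem IsDegenerate.colorable {V : Type u} [Fintype V] {G : SimpleGraph V} {k : ℕ}
    (h : IsDegenerate G k) : G.Colorable (k + 1) := by
  classical
  have key : ∀ S : Finset V, ∃ c : V → Fin (k + 1), ∀ u ∈ S, ∀ v ∈ S, G.Adj u v → c u ≠ c v := by
    intro S
    induction S using Finset.strongInduction with
    | H S ih =>
      rcases S.eq_empty_or_nonempty with rfl | hS
      · exact ⟨fun _ => 0, by simp⟩
      obtain ⟨v, hv, hdeg⟩ := h S hS
      obtain ⟨c, hc⟩ := ih _ (erase_ssubset hv)
      obtain ⟨i, hi⟩ : ∃ i, i ∉ image c {u ∈ S | G.Adj v u} := by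
        by_contra! hall
        have := card_le_card (fun i _ => hall i : (univ : Finset (Fin (k + 1))) ⊆ _)
        have := card_image_le (s := {u ∈ S | G.Adj v u}) (f := c)
        simp only [card_univ, Fintype.card_fin] at *
        omega
      simp only [mem_image, mem_filter, not_exists, not_and, and_imp] at hi
      refine ⟨Function.update c v i, fun x hx y hy hxy => ?_⟩
      by_cases hxv : x = v
      · subst hxv
        rw [Function.update_self, Function.update_of_ne hxy.ne']
        exact fun h => hi y hy hxy h.symm
      · by_cases hyv : y = v
        · subst hyv
          rw [Function.update_self, Function.update_of_ne hxv]
          exact hi x hx hxy.symm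
        · rw [Function.update_of_ne hxv, Function.update_of_ne hyv]
          exact hc x (mem_erase.2 ⟨hxv, hx⟩) y (mem_erase.2 ⟨hyv, hy⟩) hxy
  obtain ⟨c, hc⟩ := key univ
  exact ⟨SimpleGraph.Coloring.mk c fun hxy => hc _ (mem_univ _) _ (mem_univ _) hxy⟩

theorem degree_eq_card_filter {V : Type u} [Fintype V] (G : SimpleGraph V) (v : V)
    [DecidableRel G.Adj] : G.degree v = #{u | G.Adj v u} := by
  classical
  rw [← SimpleGraph.card_neighborFinset_eq_degree]
  congr 1
  ext u
  simp

open Classical in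
theorem degree_induce {V : Type u} [Fintype V] (G : SimpleGraph V) (S : Finset V)
    (v : (S : Set V)) : (G.induce (S : Set V)).degree v = #{u ∈ S | G.Adj v u} := by
  rw [degree_eq_card_filter]
  refine card_bij (fun u _ => u.1) ?_ ?_ ?_
  · rintro ⟨u, hu⟩ h
    simp only [mem_filter, mem_univ, true_and, SimpleGraph.comap_adj,
      Function.Embedding.subtype_apply] at h ⊢
    exact ⟨hu, h⟩
  · intro a _ b _ h
    exact Subtype.ext h
  · intro u hu
    simp only [mem_filter] at hu
    exact ⟨⟨u, hu.1⟩, by simpa using hu.2, rfl⟩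

theorem isDegenerate_of_averageDegree_induce_le {V : Type u} [Fintype V] {G : SimpleGraph V}
    {d : ℝ} (h : ∀ S : Finset V, averageDegree (G.induce (S : Set V)) ≤ d) :
    IsDegenerate G ⌊d⌋₊ := by
  classical
  intro S hS
  have : Nonempty (S : Set V) := hS.to_subtype
  have hav := h S
  unfold averageDegree at hav
  rw [div_le_iff₀ (by exact_mod_cast Fintype.card_pos)] at hav
  obtain ⟨v, -, hv⟩ : ∃ v ∈ (univ : Finset (S : Set V)),
      ((G.induce (S : Set V)).degree v : ℝ) ≤ d := by
    refine exists_le_of_sum_le univ_nonempty ?_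
    rw [sum_const, card_univ, nsmul_eq_mul, mul_comm]
    convert hav
  refine ⟨v, v.2, Nat.le_floor ?_⟩
  rw [← degree_induce]
  convert hv

theorem IsDegenerate.averageDegree_le {V : Type u} [Fintype V] {G : SimpleGraph V} {k : ℕ}
    (h : IsDegenerate G k) : averageDegree G ≤ 2 * k := by
  classical
  have key : ∀ S : Finset V, ∑ v ∈ S, #{u ∈ S | G.Adj v u} ≤ 2 * k * #S := by
    intro S
    induction S using Finset.strongInduction with
    | H S ih =>
      rcases S.eq_empty_or_nonempty with rfl | hS
      · simp
      obtain ⟨v, hv, hdeg⟩ := h S hS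
      have hE := ih _ (erase_ssubset hv)
      have hcard := card_erase_add_one hv
      have h1 : ∀ x ∈ S.erase v, #{u ∈ S | G.Adj x u} =
          #{u ∈ S.erase v | G.Adj x u} + if G.Adj v x then 1 else 0 := by
        intro x _
        conv_lhs => rw [← insert_erase hv, filter_insert]
        split_ifs with h1 h2 h2
        · rw [card_insert_of_notMem (by simp)]
        · exact absurd h1.symm h2
        · exact absurd h2.symm h1
        · rfl
      have h2 : ∑ x ∈ S.erase v, (if G.Adj v x then 1 else 0) ≤ #{u ∈ S | G.Adj v u} := by
        rw [← card_filter]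
        exact card_le_card (filter_subset_filter _ (erase_subset _ _))
      -- Removing `v` loses its degree twice: once as its own term, once spread over its neighbours.
      rw [← add_sum_erase _ _ hv, sum_congr rfl h1, sum_add_distrib]
      nlinarith
  rcases isEmpty_or_nonempty V with hV | hV
  · simp [averageDegree]
  unfold averageDegree
  rw [div_le_iff₀ (by exact_mod_cast Fintype.card_pos)]
  have := key univ
  simp only [← degree_eq_card_filter, card_univ] at this
  exact_mod_cast this

/-! ### A small set meeting many neighbourhoods. -/

/-- The proportion of `f : β → Fin K` for which the value `i` is attained fewer than `d` times
on `N` is exponentially small in `#N`. -/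
theorem card_filter_fiber_lt_le {β : Type u} [Fintype β] [DecidableEq β] {K : ℕ} (hK : 0 < K)
    (i : Fin K) (d M : ℕ) (N : Finset β) (hN : M ≤ #N) :
    (#{f : β → Fin K | #{u ∈ N | f u = i} < d} : ℝ) ≤
      2 ^ d * (1 - 1 / (2 * K)) ^ M * K ^ Fintype.card β := by
  have hK' : (1 : ℝ) ≤ K := by exact_mod_cast hK
  have hq0 : (0 : ℝ) ≤ 1 - 1 / (2 * K) := by
    rw [sub_nonneg, div_le_one (by positivity)]
    linarith
  have hq1 : (1 : ℝ) - 1 / (2 * K) ≤ 1 := by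
    have : (0 : ℝ) ≤ 1 / (2 * K) := by positivity
    linarith
  -- Exponential-moment bound: each hit of `i` in `N` costs a factor `1 / 2`, so fewer than `d` hits
  -- leave a product of at least `2 ^ (-d)`, while the mean factor at a point of `N` is `1 - 1 / (2
  -- * K)`.
  let g : β → Fin K → ℝ := fun u j => if u ∈ N ∧ j = i then 1 / 2 else 1
  have hg : ∀ f : β → Fin K, ∏ u, g u (f u) = (1 / 2) ^ #{u ∈ N | f u = i} := by
    intro f
    simp only [g]
    rw [prod_ite, prod_const_one, mul_one, prod_const]
    congr 2
    ext u
    simp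
  have hsum : ∀ u, ∑ j, g u j = K * if u ∈ N then 1 - 1 / (2 * (K : ℝ)) else 1 := by
    intro u
    by_cases hu : u ∈ N
    · have : ∀ j, g u j = 1 - if j = i then 1 / 2 else 0 := by
        intro j
        by_cases hj : j = i <;> simp [g, hu, hj]
        norm_num
      simp only [this, sum_sub_distrib, sum_ite_eq', mem_univ, if_true, sum_const, card_univ,
        Fintype.card_fin, nsmul_eq_mul, mul_one, hu]
      field_simp
    · simp [g, hu]
  calc (#{f : β → Fin K | #{u ∈ N | f u = i} < d} : ℝ)
      = ∑ f : β → Fin K with #{u ∈ N | f u = i} < d, (1 : ℝ) := by simp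
    _ ≤ ∑ f : β → Fin K with #{u ∈ N | f u = i} < d, 2 ^ d * ∏ u, g u (f u) := by
      refine sum_le_sum fun f hf => ?_
      have hlt := (mem_filter.1 hf).2
      rw [hg, one_div, inv_pow, ← div_eq_mul_inv, one_le_div (by positivity)]
      exact pow_le_pow_right₀ one_le_two hlt.le
    _ ≤ ∑ f : β → Fin K, 2 ^ d * ∏ u, g u (f u) := by
      refine sum_le_sum_of_subset_of_nonneg (filter_subset _ _) fun f _ _ => ?_
      rw [hg]
      positivity
    _ = 2 ^ d * ∏ u, ∑ j, g u j := by
      rw [← mul_sum, prod_univ_sum, Fintype.piFinset_univ]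
    _ = 2 ^ d * (1 - 1 / (2 * K)) ^ #N * K ^ Fintype.card β := by
      simp only [hsum, prod_mul_distrib, prod_const, card_univ]
      rw [prod_ite_mem, univ_inter, prod_const]
      ring
    _ ≤ _ := by
      gcongr ?_ * ?_ * ?_
      exact pow_le_pow_of_le_one hq0 hq1 hN

/-- If all the sets `N v` are large, then some set `T` is met at least `d` times by `N v` for more
than `R * #T` vertices `v` outside `T`. -/
theorem exists_small_set_hit_often (R d : ℕ) : ∃ M : ℕ, ∀ {V : Type u} [Fintype V] [DecidableEq V]
    [Nonempty V] (N : V → Finset V), (∀ v, M ≤ #(N v)) →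
      ∃ T : Finset V, R * #T < #{v | v ∉ T ∧ d ≤ #{u ∈ N v | u ∈ T}} := by
  -- With `2 * (R + 1)` colours, and `M` making each failure probability below `1 / 2`, the expected
  -- number of pairs (vertex, colour seen `d` times) exceeds `(R + 1) * card V`. If every colour
  -- class failed as `T`, that number would never exceed this.
  obtain ⟨K, hK, hKR⟩ : ∃ K : ℕ, 0 < K ∧ K = 2 * (R + 1) := ⟨_, by omega, rfl⟩
  have hK' : (1 : ℝ) ≤ K := by exact_mod_cast hK
  obtain ⟨M, hM⟩ := exists_pow_lt_of_lt_one (x := (1 / 2) / 2 ^ d) (y := 1 - 1 / (2 * (K : ℝ)))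
    (by positivity) (by
      have : (0 : ℝ) < 1 / (2 * K) := by positivity
      linarith)
  refine ⟨M, fun {V} _ _ _ N hN => ?_⟩
  by_contra! hcon
  have hbad : ∀ (v : V) (i : Fin K), (#{f : V → Fin K | #{u ∈ N v | f u = i} < d} : ℝ) <
      1 / 2 * K ^ Fintype.card V := by
    intro v i
    refine (card_filter_fiber_lt_le hK i d M (N v) (hN v)).trans_lt ?_
    rw [lt_div_iff₀ (by positivity)] at hM
    gcongr
    linarith
  have hgood : ∀ (v : V) (i : Fin K), (1 / 2 * K ^ Fintype.card V : ℝ) <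
      #{f : V → Fin K | d ≤ #{u ∈ N v | f u = i}} := by
    intro v i
    have h1 := card_filter_add_card_filter_not (s := (univ : Finset (V → Fin K)))
      (fun f => d ≤ #{u ∈ N v | f u = i})
    simp only [not_le, card_univ, Fintype.card_fun, Fintype.card_fin] at h1
    have h2 : (#{f : V → Fin K | d ≤ #{u ∈ N v | f u = i}} : ℝ) +
      #{f : V → Fin K | #{u ∈ N v | f u = i} < d} = K ^ Fintype.card V := by exact_mod_cast h1
    linarith [hbad v i]
  have hup : ∀ (f : V → Fin K) (i : Fin K),
      #{v | d ≤ #{u ∈ N v | f u = i}} ≤ (R + 1) * #{v | f v = i} := by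
    intro f i
    have h := hcon {v | f v = i}
    simp only [mem_filter, mem_univ, true_and] at h
    have hsub : ({v | d ≤ #{u ∈ N v | f u = i}} : Finset V) ⊆
        ({v | f v ≠ i ∧ d ≤ #{u ∈ N v | f u = i}} : Finset V) ∪ ({v | f v = i} : Finset V) := by
      intro v hv
      simp only [mem_union, mem_filter, mem_univ, true_and] at hv ⊢
      tauto
    have := (card_le_card hsub).trans (card_union_le _ _)
    linarith
  have hswap : ∑ i : Fin K, ∑ f : V → Fin K, #{v | d ≤ #{u ∈ N v | f u = i}} =
      ∑ i : Fin K, ∑ v, #{f : V → Fin K | d ≤ #{u ∈ N v | f u = i}} := by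
    refine sum_congr rfl fun i _ => ?_
    simp only [card_filter]
    exact sum_comm
  have hupper : ∑ i : Fin K, ∑ f : V → Fin K, #{v | d ≤ #{u ∈ N v | f u = i}} ≤
      K ^ Fintype.card V * ((R + 1) * Fintype.card V) := by
    rw [sum_comm]
    calc _ ≤ ∑ _f : V → Fin K, (R + 1) * Fintype.card V := by
          refine sum_le_sum fun f _ => (sum_le_sum fun i _ => hup f i).trans ?_
          rw [← mul_sum]
          refine Nat.mul_le_mul_left _ (le_of_eq ?_)
          rw [← card_univ]
          exact (card_eq_sum_card_fiberwise (fun _ _ => mem_coe.2 (mem_univ _))).symm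
      _ = _ := by simp
  have hlower : (K : ℝ) * (Fintype.card V * (1 / 2 * K ^ Fintype.card V)) <
      ∑ i : Fin K, ∑ v, (#{f : V → Fin K | d ≤ #{u ∈ N v | f u = i}} : ℝ) := by
    have : Nonempty (Fin K) := ⟨⟨0, hK⟩⟩
    calc (K : ℝ) * (Fintype.card V * (1 / 2 * K ^ Fintype.card V))
        = ∑ _i : Fin K, ∑ _v : V, (1 / 2 * K ^ Fintype.card V : ℝ) := by simp
      _ < _ := sum_lt_sum_of_nonempty univ_nonempty fun i _ =>
        sum_lt_sum_of_nonempty univ_nonempty fun v _ => hgood v i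
  rw [hswap] at hupper
  have hupper' : ∑ i : Fin K, ∑ v, (#{f : V → Fin K | d ≤ #{u ∈ N v | f u = i}} : ℝ) ≤
      K ^ Fintype.card V * ((R + 1) * Fintype.card V) := by exact_mod_cast hupper
  have hKR' : (K : ℝ) = 2 * (R + 1) := by exact_mod_cast hKR
  have : (K : ℝ) * (Fintype.card V * (1 / 2 * K ^ Fintype.card V)) =
      K ^ Fintype.card V * ((R + 1) * Fintype.card V) := by
    rw [show (R + 1 : ℝ) = K / 2 by linarith]
    ring
  linarith

/-! ### Random pairs and the union bound. -/

/-- The number of ordered pairs of elements of `N` which are not two distinct elements of `Y`. -/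
theorem card_filter_product_eq {β : Type u} [DecidableEq β] (N Y : Finset β) :
    #{p ∈ N ×ˢ N | p.1 ∈ Y → p.2 ∈ Y → p.1 = p.2} + #(N ∩ Y) * #(N ∩ Y) =
      #N * #N + #(N ∩ Y) := by
  have h1 : ({p ∈ N ×ˢ N | ¬(p.1 ∈ Y → p.2 ∈ Y → p.1 = p.2)} : Finset (β × β)) =
      (N ∩ Y).offDiag := by
    ext ⟨a, b⟩
    simp only [mem_filter, mem_product, mem_offDiag, mem_inter]
    tauto
  have h2 := card_filter_add_card_filter_not (s := N ×ˢ N)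
    (fun p => p.1 ∈ Y → p.2 ∈ Y → p.1 = p.2)
  rw [h1, offDiag_card, card_product] at h2
  have := Nat.le_mul_self #(N ∩ Y)
  omega

/-- With `p = k / n`, the left side is `n ^ 2 * (1 - p ^ 2 + p / n)`. The tangent to `p ^ 2` at `1 /
c` and `p / n ≤ p / (2 * c)` make the bound linear in the exponent, so that only the sum of the
proportions matters in a product. -/
theorem mul_self_add_sub_mul_self_le {c k n : ℝ} (hc : 0 < c) (hk : 0 ≤ k) (hn : 2 * c ≤ n) :
    n * n + k - k * k ≤ n * n * Real.exp (1 / c ^ 2 - 3 / (2 * c) * (k / n)) := by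
  have hn0 : 0 < n := by linarith
  obtain ⟨p, hp⟩ : ∃ p, p = k / n := ⟨_, rfl⟩
  have hkp : k = p * n := by rw [hp, div_mul_cancel₀ _ hn0.ne']
  have hp0 : 0 ≤ p := by rw [hp]; positivity
  have h2 : p / n ≤ p / (2 * c) := by gcongr
  have h3 : 0 ≤ (p - 1 / c) ^ 2 := sq_nonneg _
  have h4 : 1 - p ^ 2 + p / n ≤ (1 / c ^ 2 - 3 / (2 * c) * p) + 1 := by
    have e1 : (p - 1 / c) ^ 2 = p ^ 2 - 4 * (p / (2 * c)) + 1 / c ^ 2 := by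
      field_simp
      ring
    have e2 : 3 / (2 * c) * p = 3 * (p / (2 * c)) := by ring
    linarith
  rw [← hp, hkp]
  calc _ = n * n * (1 - p ^ 2 + p / n) := by
        field_simp
        ring
    _ ≤ _ := by
        gcongr
        exact h4.trans (Real.add_one_le_exp _)

theorem prod_card_filter_product_le {α β : Type u} [Fintype α] [Fintype β] [DecidableEq β]
    {c : ℕ} (hc : 0 < c) (N : α → Finset β) (hN : ∀ a, 2 * c ≤ #(N a))
    (hcard : 2 * c ^ 2 * Fintype.card β ≤ Fintype.card α) {Y : Finset β}
    (hY : (Fintype.card α / c : ℝ) ≤ ∑ a, (#(N a ∩ Y) / #(N a) : ℝ)) :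
    (∏ a, #{p ∈ N a ×ˢ N a | p.1 ∈ Y → p.2 ∈ Y → p.1 = p.2} : ℝ) ≤
      (∏ a, (#(N a) * #(N a) : ℝ)) * Real.exp (-(Fintype.card β)) := by
  have hc' : (0 : ℝ) < c := by exact_mod_cast hc
  have hterm : ∀ a, (#{p ∈ N a ×ˢ N a | p.1 ∈ Y → p.2 ∈ Y → p.1 = p.2} : ℝ) ≤
      #(N a) * #(N a) *
        Real.exp (1 / (c : ℝ) ^ 2 - 3 / (2 * (c : ℝ)) * (#(N a ∩ Y) / #(N a))) := by
    intro a
    refine le_trans (le_of_eq ?_)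
      (mul_self_add_sub_mul_self_le hc' (k := (#(N a ∩ Y) : ℝ)) (Nat.cast_nonneg _) ?_)
    · rw [eq_sub_iff_add_eq]
      exact_mod_cast card_filter_product_eq (N a) Y
    · exact_mod_cast hN a
  refine (prod_le_prod (fun a _ => Nat.cast_nonneg _) fun a _ => hterm a).trans ?_
  rw [prod_mul_distrib, ← Real.exp_sum]
  refine mul_le_mul_of_nonneg_left (Real.exp_le_exp.2 ?_)
    (prod_nonneg fun a _ => mul_self_nonneg _)
  rw [sum_sub_distrib, ← mul_sum, sum_const, card_univ, nsmul_eq_mul]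
  generalize (∑ a, (#(N a ∩ Y) / #(N a) : ℝ)) = σ at hY ⊢
  have hcard' : (2 * (c : ℝ) ^ 2 * Fintype.card β : ℝ) ≤ Fintype.card α := by exact_mod_cast hcard
  generalize (Fintype.card α : ℝ) = x at hY hcard' ⊢
  generalize (Fintype.card β : ℝ) = y at hcard' ⊢
  -- The exponent is at most `x / c ^ 2 - 3 * x / (2 * c ^ 2) = -x / (2 * c ^ 2)`, hence at most
  -- `-y`.
  have h1 : 3 / (2 * (c : ℝ)) * (x / c) ≤ 3 / (2 * c) * σ :=
    mul_le_mul_of_nonneg_left hY (by positivity)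
  have h2 : y ≤ x / (2 * (c : ℝ) ^ 2) := by
    rw [le_div_iff₀ (by positivity)]
    linarith
  have h3 : 3 / (2 * (c : ℝ)) * (x / c) = 3 * (x / (2 * (c : ℝ) ^ 2)) := by
    field_simp
  have h4 : x * (1 / (c : ℝ) ^ 2) = 2 * (x / (2 * (c : ℝ) ^ 2)) := by
    field_simp
  linarith

/-- If the sets `N a` are large and there are many of them, then one can choose a pair in each of
them so that any set `Y` containing no two distinct elements of a chosen pair covers, on average,
less than the proportion `1 / c` of the sets. -/
theorem exists_pairs_forall_sum_lt {α β : Type u} [Fintype α] [Fintype β] [DecidableEq β]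
    [Nonempty β] {c : ℕ} (hc : 0 < c) (N : α → Finset β) (hN : ∀ a, 2 * c ≤ #(N a))
    (hcard : 2 * c ^ 2 * Fintype.card β ≤ Fintype.card α) :
    ∃ g : α → β × β, (∀ a, g a ∈ N a ×ˢ N a) ∧ ∀ Y : Finset β,
      (∀ a, (g a).1 ∈ Y → (g a).2 ∈ Y → (g a).1 = (g a).2) →
        ∑ a, (#(N a ∩ Y) / #(N a) : ℝ) < Fintype.card α / c := by
  classical
  by_contra! hcon
  have hNpos : ∀ a, (0 : ℝ) < #(N a) := fun a => by
    have := hN a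
    exact_mod_cast (by omega : 0 < #(N a))
  set bad : Finset (Finset β) :=
    {Y | (Fintype.card α / c : ℝ) ≤ ∑ a, (#(N a ∩ Y) / #(N a) : ℝ)}
  -- If every choice of pairs fails, the choices compatible with some heavy `Y` exhaust the whole
  -- product space.
  have hsub : Fintype.piFinset (fun a => N a ×ˢ N a) ⊆ bad.biUnion fun Y =>
      Fintype.piFinset fun a => {p ∈ N a ×ˢ N a | p.1 ∈ Y → p.2 ∈ Y → p.1 = p.2} := by
    intro g hg
    rw [Fintype.mem_piFinset] at hg
    obtain ⟨Y, hY, hle⟩ := hcon g hg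
    refine mem_biUnion.2 ⟨Y, mem_filter.2 ⟨mem_univ _, hle⟩, Fintype.mem_piFinset.2 fun a => ?_⟩
    exact mem_filter.2 ⟨hg a, hY a⟩
  have hle := (card_le_card hsub).trans card_biUnion_le
  simp only [Fintype.card_piFinset, card_product] at hle
  have hle' : (∏ a, (#(N a) * #(N a) : ℝ)) ≤ ∑ Y ∈ bad, ∏ a,
      (#{p ∈ N a ×ˢ N a | p.1 ∈ Y → p.2 ∈ Y → p.1 = p.2} : ℝ) := by exact_mod_cast hle
  have hP : 0 < ∏ a, (#(N a) * #(N a) : ℝ) := prod_pos fun a _ => mul_pos (hNpos a) (hNpos a)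
  have hprod : ∀ Y ∈ bad, ∏ a, (#{p ∈ N a ×ˢ N a | p.1 ∈ Y → p.2 ∈ Y → p.1 = p.2} : ℝ) ≤
      (∏ a, (#(N a) * #(N a) : ℝ)) * Real.exp (-(Fintype.card β)) := fun Y hY =>
    prod_card_filter_product_le hc N hN hcard (mem_filter.1 hY).2
  have hfinal := hle'.trans (sum_le_sum hprod)
  rw [sum_const, nsmul_eq_mul] at hfinal
  have hbadcard : (#bad : ℝ) ≤ 2 ^ Fintype.card β := by
    have := card_le_univ bad
    rw [Fintype.card_finset] at this
    exact_mod_cast this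
  -- The union bound closes because `2 < e` and `β` is nonempty.
  have hlt : (2 : ℝ) ^ Fintype.card β * Real.exp (-(Fintype.card β)) < 1 := by
    rw [Real.exp_neg, ← div_eq_mul_inv, div_lt_one (Real.exp_pos _), ← Real.exp_one_pow]
    exact pow_lt_pow_left₀ (lt_trans (by norm_num) Real.exp_one_gt_d9) zero_le_two
      Fintype.card_ne_zero
  generalize (∏ a, (#(N a) * #(N a) : ℝ)) = P at hP hfinal
  have h1 : (#bad : ℝ) * Real.exp (-(Fintype.card β)) < 1 :=
    (mul_le_mul_of_nonneg_right hbadcard (Real.exp_pos _).le).trans_lt hlt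
  have h2 := mul_lt_mul_of_pos_right h1 hP
  linarith

/-! ### The depth-1 minor of large fractional chromatic number. -/

theorem lt_fractionalChromaticNumber {V : Type u} [Fintype V] {G : SimpleGraph V} {c : ℝ}
    {w : V → ℝ} (hw : ∀ v, 0 ≤ w v)
    (h : ∀ Y : Finset V, G.IsIndepSet (Y : Set V) → c * ∑ y ∈ Y, w y < ∑ v, w v) :
    c < fractionalChromaticNumber G := by
  have hsum : 0 < ∑ v, w v := by simpa using h ∅ (by simp)
  obtain ⟨v, -, hv⟩ : ∃ v ∈ univ, w v ≠ 0 := exists_ne_zero_of_sum_ne_zero hsum.ne'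
  have hpos : 0 < maxIndepWeight G w :=
    lt_of_lt_of_le (lt_of_le_of_ne (hw v) hv.symm) (le_maxIndepWeight G w v)
  refine lt_of_lt_of_le ?_ (le_csSup (bddAbove_weightRatios G) ⟨w, ⟨hw, v, hv⟩, rfl⟩)
  rw [lt_div_iff₀ hpos]
  obtain ⟨Y, hY, hYw⟩ := exists_mem_eq_sup' (indepSets_nonempty G) fun Y => ∑ y ∈ Y, w y
  rw [maxIndepWeight, hYw]
  exact h Y (mem_indepSets.1 hY)

open Classical in
/-- A graph of large minimum degree has a shallow minor at depth `1` with large fractional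
chromatic number. -/
theorem exists_shallowMinor_lt_fractionalChromaticNumber (c : ℕ) : ∃ M : ℕ, ∀ {V : Type u}
    [Fintype V] [Nonempty V] (G : SimpleGraph V), (∀ v, M ≤ G.degree v) →
      ∃ (T : Finset V) (H : SimpleGraph T), IsShallowMinor 1 H G ∧
        (c : ℝ) < fractionalChromaticNumber H := by
  wlog hc : 0 < c generalizing c
  · obtain ⟨M, hM⟩ := this 1 one_pos
    refine ⟨M, fun G hG => ?_⟩
    obtain ⟨T, H, hH, hlt⟩ := hM G hG
    refine ⟨T, H, hH, lt_trans ?_ hlt⟩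
    exact_mod_cast (by omega : c < 1)
  obtain ⟨M, hM⟩ := exists_small_set_hit_often.{u} (2 * c ^ 2) (2 * c)
  refine ⟨M, fun {V} _ _ G hG => ?_⟩
  obtain ⟨T, hT⟩ := hM (fun v => ({u | G.Adj v u} : Finset V))
    fun v => by rw [← degree_eq_card_filter]; exact hG v
  set A : Finset V := {v | v ∉ T ∧ 2 * c ≤ #{u ∈ ({u | G.Adj v u} : Finset V) | u ∈ T}} with hA
  have hAT : ∀ a ∈ A, a ∉ T := fun a ha => (mem_filter.1 ha).2.1
  let N : A → Finset T := fun a => {u | G.Adj a u}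
  have hN : ∀ a, 2 * c ≤ #(N a) := by
    intro a
    refine (mem_filter.1 a.2).2.2.trans (le_of_eq ?_)
    symm
    refine card_bij (fun u _ => u.1) ?_ (fun a _ b _ h => Subtype.ext h) ?_
    · intro u hu
      simpa [N] using hu
    · intro u hu
      simp only [mem_filter, mem_univ, true_and] at hu
      exact ⟨⟨u, hu.2⟩, by simpa [N] using hu.1, rfl⟩
  have hAne : 0 < #A := (Nat.zero_le _).trans_lt hT
  have hTne : Nonempty T := by
    obtain ⟨a, ha⟩ := card_pos.1 hAne
    have : 0 < #(N ⟨a, ha⟩) := by have := hN ⟨a, ha⟩; omega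
    exact ⟨(card_pos.1 this).choose⟩
  obtain ⟨g, hgN, hg⟩ := exists_pairs_forall_sum_lt hc N hN (by simpa using hT.le)
  have hg1 : ∀ a : A, G.Adj a (g a).1 := fun a => (mem_filter.1 (mem_product.1 (hgN a)).1).2
  have hg2 : ∀ a : A, G.Adj a (g a).2 := fun a => (mem_filter.1 (mem_product.1 (hgN a)).2).2
  -- Stars: `x` together with the `a` whose first choice is `x`. The second choice gives the edge.
  let B : T → Set V := fun x => {v | v = x ∨ ∃ a : A, a.1 = v ∧ (g a).1 = x}
  have hBe : ∀ a : A, ∃ v ∈ B (g a).1, ∃ v' ∈ B (g a).2, G.Adj v v' := fun a =>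
    ⟨a, Or.inr ⟨a, rfl, rfl⟩, (g a).2, Or.inl rfl, hg2 a⟩
  -- `fromRel` discards the loops coming from pairs with equal entries.
  refine ⟨T, SimpleGraph.fromRel fun x y => ∃ a, g a = (x, y),
    isShallowMinor_iff.2 ⟨B, ?_, ?_, ?_⟩, ?_⟩
  · intro x
    refine ⟨x, Or.inl rfl, ?_⟩
    rintro v (rfl | ⟨a, rfl, rfl⟩)
    · exact ⟨.nil, by simp, by simp [B]⟩
    · refine ⟨.cons (hg1 a).symm .nil, by simp, ?_⟩
      intro u hu
      simp only [SimpleGraph.Walk.support_cons, SimpleGraph.Walk.support_nil, List.mem_cons,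
        List.not_mem_nil, or_false] at hu
      rcases hu with rfl | rfl
      · exact Or.inl rfl
      · exact Or.inr ⟨a, rfl, rfl⟩
  · intro x y hxy
    refine Set.disjoint_left.2 ?_
    rintro v (rfl | ⟨a, rfl, rfl⟩) (h | ⟨b, h, rfl⟩)
    · exact hxy (Subtype.ext h)
    · exact hAT _ b.2 (h ▸ x.2)
    · exact hAT _ a.2 (h ▸ y.2)
    · exact hxy (by rw [Subtype.ext h])
  · rintro x y ⟨-, ⟨a, ha⟩ | ⟨a, ha⟩⟩
    · simpa [ha] using hBe a
    · obtain ⟨v, hv, v', hv', h⟩ := hBe a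
      rw [ha] at hv hv'
      exact ⟨v', hv', v, hv, h.symm⟩
  · have hsum : ∀ Y : Finset T, ∑ y ∈ Y, ∑ a, (if y ∈ N a then (1 / #(N a) : ℝ) else 0) =
        ∑ a, (#(N a ∩ Y) / #(N a) : ℝ) := by
      intro Y
      rw [sum_comm]
      refine sum_congr rfl fun a _ => ?_
      rw [sum_ite_mem, sum_const, nsmul_eq_mul, inter_comm, mul_one_div]
    -- Each `a` distributes weight `1` evenly over `N a`, so the total weight is `#A`.
    refine lt_fractionalChromaticNumber 
      (w := fun y => ∑ a, (if y ∈ N a then (1 / #(N a) : ℝ) else 0))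
      (fun y => sum_nonneg fun a _ => by positivity) fun Y hY => ?_
    have hlt := hg Y fun a h1 h2 => by
      by_contra hne
      exact hY (mem_coe.2 h1) (mem_coe.2 h2) hne ⟨hne, Or.inl ⟨a, rfl⟩⟩
    rw [hsum, hsum]
    have htot : ∑ a, (#(N a ∩ univ) / #(N a) : ℝ) = Fintype.card A := by
      rw [← card_univ, card_eq_sum_ones, Nat.cast_sum]
      refine sum_congr rfl fun a _ => ?_
      have : (#(N a) : ℝ) ≠ 0 := by
        have := hN a
        exact_mod_cast (by omega : #(N a) ≠ 0)
      rw [inter_univ, div_self this, Nat.cast_one]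
    rw [htot, mul_comm]
    exact (lt_div_iff₀ (by exact_mod_cast hc)).1 hlt

end ShallowMinors

/-! ### The equivalence. -/

theorem mainTheorem4 (C : Set ShallowMinors.FiniteGraph.{u}) :
    ShallowMinors.HasBoundedExpansion C ↔
      ∃ f : ℕ → ℕ, ∀ r : ℕ, ∀ H ∈ ShallowMinors.shallowMinors C r,
        ShallowMinors.fractionalChromaticNumber H.graph ≤ (f r : ℝ) := by
  classical
  open ShallowMinors in
  constructor
  · rintro ⟨f, hf⟩
    refine ⟨fun r => ⌊f r⌋₊ + 1, fun r H ⟨G, hG, hH⟩ => ?_⟩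
    have hdeg : IsDegenerate H.graph ⌊f r⌋₊ := isDegenerate_of_averageDegree_induce_le fun S =>
      hf r ⟨_, H.graph.induce (S : Set H.V)⟩ ⟨G, hG, hH.induce _⟩
    obtain ⟨c⟩ := hdeg.colorable
    exact fractionalChromaticNumber_le_of_coloring c
  · rintro ⟨f, hf⟩
    choose M hM using exists_shallowMinor_lt_fractionalChromaticNumber.{u}
    -- The threshold `M` is taken at the bound for depth `3r + 1`, where the composed minor lives;
    -- the factor `2` passes from degeneracy to average degree.
    refine ⟨fun r => 2 * (M (f (1 * (2 * r + 1) + r)) : ℕ), fun r H ⟨G, hG, hH⟩ => ?_⟩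
    refine IsDegenerate.averageDegree_le fun S hS => ?_
    by_contra! hcon
    have : Nonempty (S : Set H.V) := hS.to_subtype
    obtain ⟨T, F, hF, hlt⟩ := hM (f (1 * (2 * r + 1) + r)) (H.graph.induce (S : Set H.V))
      fun v => by
        have hv := hcon v v.2
        rw [← degree_induce] at hv
        refine hv.le.trans_eq ?_
        congr!
    exact absurd (hf _ ⟨_, F⟩ ⟨G, hG, hF.trans (hH.induce _)⟩) (not_le.2 hlt)
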